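/- For a metric space $(X,d)$ and real numbers $\mu,\delta\ge 0$, say that $(X,d)$ satisfies the $(\mu,\delta)$-four-point inequality if for all $x,y,z,w\in X$ $$d(x,y)+d(z,w)\le \mu\max\{d(x,z)+d(y,w),\; d(x,w)+d(y,z)\}+2\delta .$$ The quasi-hyperbolicity constant of $(X,d)$ is $$C(X,d)=\inf\{\mu\ge 0 \;:\; \text{there exists } \delta\ge 0 \text{ such that } (X,d) \text{ satisfies the } (\mu,\delta)\text{-four-point inequality}\}.$$ For a real Banach space $B$, let $C(B)$ denote the quasi-hyperbolicity constant of $B$ with the metric $d(u,v)=\|u-v\|$. Theorem. Let $B$ be a real Banach space, of finite or infinite dimension. 1. If $\dim B\ge 2$, then $C(B)\ge\sqrt 2$. 2. If $\dim B\ge 3$ and $C(B)=\sqrt 2$, then $B$ is a Hilbert space, that is, the norm of $B$ is induced by an inner product. -/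

import Mathlib

/-- A metric space `X` satisfies the `(μ, δ)`-four-point inequality. -/
def FourPointInequality (X : Type*) [MetricSpace X] (μ δ : ℝ) : Prop :=
  ∀ x y z w : X,
    dist x y + dist z w ≤ μ * max (dist x z + dist y w) (dist x w + dist y z) + 2 * δ

/-- The quasi-hyperbolicity constant `C(X, d)`: the infimum of all `μ ≥ 0` for which some
`(μ, δ)`-four-point inequality with `δ ≥ 0` holds. The set always contains `2` and is bounded
below by `0`, so the real infimum is a genuine one. -/
noncomputable def quasiHyperbolicityConstant (X : Type*) [MetricSpace X] : ℝ :=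
  sInf {μ : ℝ | 0 ≤ μ ∧ ∃ δ : ℝ, 0 ≤ δ ∧ FourPointInequality X μ δ}

/-- A real normed space is a Hilbert space: it is complete and its given norm (together with its
given scalar multiplication) comes from a real inner product. -/
def IsHilbertSpace (B : Type*) [NormedAddCommGroup B] [nB : NormedSpace ℝ B] : Prop :=
  CompleteSpace B ∧ ∃ ip : InnerProductSpace ℝ B, ip.toNormedSpace = nB

open Filter Topology Asymptotics

/-! Dilating a four-point configuration makes the additive constant negligible, so on the
parallelogram `0, u, v, u + v` an admissible `μ` satisfies `‖u + v‖ + ‖u - v‖ ≤ 2 * μ * max ‖u‖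
‖v‖`. For unit vectors `p, q` with `‖p + q‖ = ‖p - q‖`, this bound at `(p, q)` and at `(p + q, p -
q)` gives `μ ^ 2 ≥ 2`.

If the constant is `√2`, then `SquareBound` holds and all such pairs satisfy `‖p ± q‖ = √2`. In a
three-dimensional subspace, take a point `p` where the norm is differentiable. The norm is then
differentiable at `p ± q` too, and differentiating the two constant norms shows that the derivative
at `p` is constant along the partners `q` of `p`; oddness makes it zero
(`UnitPerp.apply_eq_zero_of_hasFDerivAt`). Density of smooth points and compactness carry this to
all `p`: the partners of `p` are the unit vectors of a plane.

Isosceles orthogonality is therefore a symmetric linear relation without isotropic vectors. In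
suitable coordinates its coefficients form a ring endomorphism of `ℝ`, hence the identity, so
orthogonality implies vanishing of the dot product (`inner_eq_zero_of_polarity`). As `x + y` and `x
- y` are orthogonal for orthogonal unit `x, y`, all unit vectors have the same Euclidean length. The
parallelogram law follows, and Jordan–von Neumann concludes. -/

/-- The James-type bound `‖u + v‖ + ‖u - v‖ ≤ 2 √2 max ‖u‖ ‖v‖`. -/
def SquareBound (E : Type*) [NormedAddCommGroup E] : Prop :=
  ∀ u v : E, ‖u + v‖ + ‖u - v‖ ≤ 2 * √2 * max ‖u‖ ‖v‖

/-- Isosceles orthogonality of unit vectors. -/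
structure UnitPerp {E : Type*} [NormedAddCommGroup E] (p q : E) : Prop where
  left : ‖p‖ = 1
  right : ‖q‖ = 1
  iso : ‖p + q‖ = ‖p - q‖

/-! ### From the four-point inequality to a bound on parallelograms. -/

section FourPoint

variable {X : Type*} [MetricSpace X]

lemma fourPointInequality_two : FourPointInequality X 2 0 := by
  intro x y z w
  have h1 := dist_triangle x z y
  have h2 := dist_triangle x w y
  have h3 := dist_triangle z x w
  have h4 := dist_triangle z y w
  have h5 := le_max_left (dist x z + dist y w) (dist x w + dist y z)
  have h6 := le_max_right (dist x z + dist y w) (dist x w + dist y z)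
  rw [dist_comm z y] at h1 h4
  rw [dist_comm w y] at h2
  rw [dist_comm z x] at h3
  linarith

variable {E : Type*} [NormedAddCommGroup E] [NormedSpace ℝ E]

lemma FourPointInequality.norm_add_norm_le {μ δ : ℝ} (h : FourPointInequality E μ δ) (u v : E) :
    ‖u + v‖ + ‖u - v‖ ≤ 2 * μ * max ‖u‖ ‖v‖ := by
  have key : ∀ t : ℝ, 0 < t →
      -- The parallelogram scaled by `t`: the left side grows linearly while `δ` stays fixed.
      (‖u + v‖ + ‖u - v‖ - 2 * μ * max ‖u‖ ‖v‖) * t ≤ 2 * δ := by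
    intro t ht
    have := h 0 (t • (u + v)) (t • u) (t • v)
    have e1 : t • (u + v) - t • v = t • u := by rw [smul_add]; abel
    have e2 : t • (u + v) - t • u = t • v := by rw [smul_add]; abel
    simp only [dist_eq_norm, zero_sub, norm_neg, ← smul_sub, e1, e2] at this
    simp only [norm_smul, Real.norm_eq_abs,
      abs_of_pos ht] at this
    have e3 : max (t * ‖u‖ + t * ‖u‖) (t * ‖v‖ + t * ‖v‖) = 2 * t * max ‖u‖ ‖v‖ := by
      rw [mul_max_of_nonneg _ _ (by positivity)]; congr 1 <;> ring
    rw [e3] at this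
    linarith
  by_contra! hlt
  set d := ‖u + v‖ + ‖u - v‖ - 2 * μ * max ‖u‖ ‖v‖ with hd
  have hd0 : 0 < d := by linarith
  have h1 := key ((|2 * δ| + 1) / d) (by positivity)
  rw [mul_div_cancel₀ _ hd0.ne'] at h1
  linarith [le_abs_self (2 * δ)]

/-- The infimum need not be attained, so the bound is obtained for `μ` slightly above `√2`, with `ε`
scaled by the size of `u` and `v`. -/
lemma squareBound_of_quasiHyperbolicityConstant_eq
    (h : quasiHyperbolicityConstant E = √2) : SquareBound E := by
  intro u v
  have hne : {μ : ℝ | 0 ≤ μ ∧ ∃ δ : ℝ, 0 ≤ δ ∧ FourPointInequality E μ δ}.Nonempty :=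
    ⟨2, by norm_num, 0, le_rfl, fourPointInequality_two⟩
  refine le_of_forall_pos_le_add fun ε hε => ?_
  set M := max ‖u‖ ‖v‖ with hM
  have hM0 : 0 ≤ M := (norm_nonneg u).trans (le_max_left _ _)
  obtain ⟨μ, ⟨-, δ, -, hμ⟩, hlt⟩ := exists_lt_of_csInf_lt hne
    (show sInf _ < √2 + ε / (2 * (M + 1)) by
      rw [← quasiHyperbolicityConstant, h]
      have : 0 < ε / (2 * (M + 1)) := by positivity
      linarith)
  have h1 := hμ.norm_add_norm_le u v
  rw [← hM] at h1
  have h2 : 2 * μ * M ≤ 2 * (√2 + ε / (2 * (M + 1))) * M := by gcongr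
  have h3 : 2 * (ε / (2 * (M + 1))) * M ≤ ε := by
    have : 2 * (ε / (2 * (M + 1))) * M = ε * (M / (M + 1)) := by field_simp
    rw [this]
    have : M / (M + 1) ≤ 1 := by rw [div_le_one (by positivity)]; linarith
    nlinarith
  linarith

end FourPoint

/-! ### Isosceles orthogonal unit vectors and the lower bound. -/

section Perp

variable {E : Type*} [NormedAddCommGroup E]

namespace UnitPerp

variable {p q : E}

lemma symm (h : UnitPerp p q) : UnitPerp q p :=
  ⟨h.right, h.left, by rw [add_comm, h.iso, norm_sub_rev]⟩

lemma neg_right (h : UnitPerp p q) : UnitPerp p (-q) :=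
  ⟨h.left, by rw [norm_neg, h.right], by rw [sub_neg_eq_add, ← sub_eq_add_neg, h.iso]⟩

/-- The bound at `(p, q)` gives `≤`; at `(p + q, p - q)`, whose sum and difference are `2p` and
`2q`, it gives `≥`. -/
lemma norm_add (hE : SquareBound E) [NormedSpace ℝ E] (h : UnitPerp p q) : ‖p + q‖ = √2 := by
  have h1 := hE p q
  have h2 := hE (p + q) (p - q)
  have e1 : p + q + (p - q) = (2 : ℝ) • p := by rw [two_smul]; abel
  have e2 : p + q - (p - q) = (2 : ℝ) • q := by rw [two_smul]; abel
  rw [e1, e2, norm_smul, norm_smul, h.left, h.right, ← h.iso, max_self] at h2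
  rw [h.left, h.right, ← h.iso, max_self] at h1
  norm_num at h2
  have h3 : √2 * √2 = 2 := Real.mul_self_sqrt (by norm_num)
  have h4 : 0 < √2 := by positivity
  refine le_antisymm (by linarith) ?_
  refine le_of_mul_le_mul_left ?_ h4
  linarith

lemma norm_sub (hE : SquareBound E) [NormedSpace ℝ E] (h : UnitPerp p q) : ‖p - q‖ = √2 := by
  rw [← h.iso, h.norm_add hE]

end UnitPerp

variable [NormedSpace ℝ E]

lemma exists_unitPerp {p y : E} (hp : ‖p‖ = 1) (hy : ∀ c : ℝ, y ≠ c • p) :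
    ∃ s t : ℝ, 0 < t ∧ UnitPerp p (s • p + t • y) := by
  have hp0 : p ≠ 0 := by rintro rfl; simp at hp
  -- A path from `-p` through `y` to `p`, avoiding `0`. Once normalized, the intermediate value
  -- theorem applies to `‖p + z‖ - ‖p - z‖`; the zero is not an endpoint, whence `t > 0`.
  let x : ℝ → E := fun τ => τ • p + (1 - |τ|) • y
  have hx : ∀ τ, x τ ≠ 0 := by
    intro τ h0
    by_cases h1 : 1 - |τ| = 0
    · have h0' : τ • p + (1 - |τ|) • y = 0 := h0
      rw [h1, zero_smul, add_zero, smul_eq_zero] at h0'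
      rcases h0' with h | h
      · simp [h] at h1
      · exact hp0 h
    · refine hy (-(1 - |τ|)⁻¹ * τ) ?_
      have h0' : (1 - |τ|) • y = -(τ • p) := by
        rw [eq_neg_iff_add_eq_zero, add_comm]; exact h0
      rw [mul_smul, neg_smul, ← smul_neg, ← h0', smul_smul, inv_mul_cancel₀ h1, one_smul]
  have hxc : Continuous x := by fun_prop
  let z : ℝ → E := fun τ => ‖x τ‖⁻¹ • x τ
  have hzc : Continuous z := (hxc.norm.inv₀ fun τ => norm_ne_zero_iff.2 (hx τ)).smul hxc
  have hzn : ∀ τ, ‖z τ‖ = 1 := fun τ => norm_smul_inv_norm (𝕜 := ℝ) (hx τ)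
  let f : ℝ → ℝ := fun τ => ‖p + z τ‖ - ‖p - z τ‖
  have hf : Continuous f := by fun_prop
  have hz1 : z 1 = p := by simp [z, x, hp]
  have hz2 : z (-1) = -p := by simp [z, x, hp]
  have h2p : ‖p + p‖ = 2 := by rw [← two_smul ℝ p, norm_smul, hp]; norm_num
  have hf1 : f 1 = 2 := by simp [f, hz1, h2p]
  have hf2 : f (-1) = -2 := by simp [f, hz2, h2p]
  obtain ⟨τ, hτ, h0⟩ := intermediate_value_Icc (show (-1 : ℝ) ≤ 1 by norm_num) hf.continuousOn
    (show (0 : ℝ) ∈ Set.Icc (f (-1)) (f 1) by rw [hf1, hf2]; constructor <;> norm_num)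
  have hτ1 : τ ≠ 1 := by rintro rfl; rw [hf1] at h0; norm_num at h0
  have hτ2 : τ ≠ -1 := by rintro rfl; rw [hf2] at h0; norm_num at h0
  have habs : |τ| < 1 :=
    abs_lt.2 ⟨lt_of_le_of_ne hτ.1 hτ2.symm, lt_of_le_of_ne hτ.2 hτ1⟩
  have hzτ : (‖x τ‖⁻¹ * τ) • p + (‖x τ‖⁻¹ * (1 - |τ|)) • y = z τ := by
    simp only [z, x, smul_add, smul_smul]
  refine ⟨‖x τ‖⁻¹ * τ, ‖x τ‖⁻¹ * (1 - |τ|),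
    mul_pos (inv_pos.2 (norm_pos_iff.2 (hx τ))) (by linarith), ?_⟩
  rw [hzτ]
  exact ⟨hp, hzn τ, sub_eq_zero.1 h0⟩

lemma sqrt_two_le_of_fourPointInequality (hE : 2 ≤ Module.rank ℝ E) {μ δ : ℝ} (hμ : 0 ≤ μ)
    (h : FourPointInequality E μ δ) : √2 ≤ μ := by
  obtain ⟨p, hp⟩ : ∃ p : E, ‖p‖ = 1 := by
    have : Nontrivial E := by
      rw [← rank_pos_iff_nontrivial (R := ℝ)]
      exact lt_of_lt_of_le (by norm_num) hE
    exact exists_norm_eq E zero_le_one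
  obtain ⟨y, hy⟩ : ∃ y : E, ∀ c : ℝ, y ≠ c • p := by
    by_contra! hc
    have : Module.rank ℝ E ≤ 1 := rank_le_one_iff.2 ⟨p, fun y => (hc y).imp fun c hc => hc.symm⟩
    exact absurd (hE.trans this) (by norm_num)
  obtain ⟨s, t, -, hq⟩ := exists_unitPerp hp hy
  generalize s • p + t • y = q at hq
  have h1 := h.norm_add_norm_le p q
  have h2 := h.norm_add_norm_le (p + q) (p - q)
  have e1 : p + q + (p - q) = (2 : ℝ) • p := by rw [two_smul]; abel
  have e2 : p + q - (p - q) = (2 : ℝ) • q := by rw [two_smul]; abel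
  rw [e1, e2, norm_smul, norm_smul, hq.left, hq.right, ← hq.iso, max_self] at h2
  rw [hq.left, hq.right, ← hq.iso, max_self] at h1
  norm_num at h2
  refine Real.sqrt_le_iff.2 ⟨hμ, ?_⟩
  nlinarith

lemma sqrt_two_le_quasiHyperbolicityConstant (hE : 2 ≤ Module.rank ℝ E) :
    √2 ≤ quasiHyperbolicityConstant E :=
  le_csInf ⟨2, by norm_num, 0, le_rfl, fourPointInequality_two⟩
    fun _ ⟨hμ, _, _, h⟩ => sqrt_two_le_of_fourPointInequality hE hμ h

end Perp

/-! ### Supporting functionals, Lipschitz dependence and differentiability. -/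

section Support

variable {E : Type*} [NormedAddCommGroup E] [NormedSpace ℝ E]

/-- `ψ` is a norm-one functional attaining its norm at `x`. -/
structure Supports (ψ : E →L[ℝ] ℝ) (x : E) : Prop where
  le_norm : ∀ y, ψ y ≤ ‖y‖
  self : ψ x = ‖x‖

lemma exists_supports (x : E) : ∃ ψ : E →L[ℝ] ℝ, Supports ψ x := by
  obtain ⟨ψ, h1, h2⟩ := exists_dual_vector'' ℝ x
  refine ⟨ψ, fun y => (le_abs_self _).trans ?_, by simpa using h2⟩
  exact (ψ.le_opNorm y).trans (mul_le_of_le_one_left (norm_nonneg _) h1)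

namespace Supports

variable {ψ : E →L[ℝ] ℝ} {x : E}

lemma abs_le_norm (h : Supports ψ x) (y : E) : |ψ y| ≤ ‖y‖ := by
  refine abs_le.2 ⟨?_, h.le_norm y⟩
  have := h.le_norm (-y)
  rw [map_neg, norm_neg] at this
  linarith

lemma norm_le_one (h : Supports ψ x) : ‖ψ‖ ≤ 1 :=
  ψ.opNorm_le_bound zero_le_one fun y => by
    rw [one_mul, Real.norm_eq_abs]; exact h.abs_le_norm y

lemma of_hasFDerivAt (h : HasFDerivAt (fun y : E => ‖y‖) ψ x) : Supports ψ x := by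
  refine ⟨fun y => (le_abs_self _).trans ?_, ?_⟩
  · have h1 : ‖ψ‖ ≤ (1 : NNReal) := by
      rw [← h.fderiv]; exact norm_fderiv_le_of_lipschitz ℝ lipschitzWith_one_norm
    exact (ψ.le_opNorm y).trans (mul_le_of_le_one_left (norm_nonneg _) h1)
  · rw [← h.fderiv]; exact h.differentiableAt.fderiv_norm_self

end Supports

lemma one_lt_sqrt_two : (1 : ℝ) < √2 := by
  rw [Real.lt_sqrt] <;> norm_num

/-- A unit vector isosceles orthogonal to `p` depends Lipschitz continuously on its direction
modulo `p`. -/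
lemma UnitPerp.norm_sub_le (hE : SquareBound E) {p q₁ q₂ y₁ y₂ : E} {s₁ s₂ t₁ t₂ : ℝ}
    (h₁ : UnitPerp p q₁) (h₂ : UnitPerp p q₂) (e₁ : q₁ = s₁ • p + t₁ • y₁)
    (e₂ : q₂ = s₂ • p + t₂ • y₂) (ht : 0 < t₁) (htt : t₁ ≤ t₂) :
    ‖q₂ - q₁‖ ≤ 4 * ‖t₂ • (y₂ - y₁)‖ := by
  obtain ⟨β, hβ⟩ := exists_supports (p + q₁)
  obtain ⟨α, hα⟩ := exists_supports (p - q₁)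
  set d := t₂ / t₁ with hd
  have hd1 : 1 ≤ d := (one_le_div ht).2 htt
  set c := s₂ - d * s₁ with hc
  set e := t₂ • (y₂ - y₁) with he
  have hdt : d * t₁ = t₂ := div_mul_cancel₀ _ ht.ne'
  -- Since `‖p ± q₁‖ = ‖p ± q₂‖ = √2`, one has `β (q₂ - q₁) ≤ 0 ≤ α (q₂ - q₁)`. The sign of `c`
  -- decides which of the two bounds `c` and `d - 1` by `e`.
  have hΔ : q₂ - q₁ = c • p + (d - 1) • q₁ + e := by
    have : q₂ = c • p + d • q₁ + e := by
      rw [e₁, e₂, he, hc, smul_add, smul_smul, smul_smul, hdt, smul_sub, sub_smul]; abel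
    rw [this, sub_smul d, one_smul]; abel
  have hβ1 := hβ.self
  have hα1 := hα.self
  rw [h₁.norm_add hE, map_add] at hβ1
  rw [h₁.norm_sub hE, map_sub] at hα1
  have hβ2 := hβ.le_norm (p + q₂)
  have hα2 := hα.le_norm (p - q₂)
  rw [h₂.norm_add hE, map_add] at hβ2
  rw [h₂.norm_sub hE, map_sub] at hα2
  have hβp := hβ.le_norm p
  have hβq := hβ.le_norm q₁
  have hαp := hα.le_norm p
  have hαq := neg_le_of_abs_le (hα.abs_le_norm q₁)
  rw [h₁.left] at hβp hαp
  rw [h₁.right] at hβq hαq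
  have hβe := neg_le_of_abs_le (hβ.abs_le_norm e)
  have hαe := hα.le_norm e
  have hβΔ := congrArg β hΔ
  have hαΔ := congrArg α hΔ
  simp only [map_add, map_sub, map_smul, smul_eq_mul] at hβΔ hαΔ
  -- Each of `β p`, `β q₁`, `α p`, `-α q₁` is at least `√2 - 1 > 0.4`, which yields the factor `1 /
  -- 0.4 ≤ 3`.
  have hs : (1.4 : ℝ) < √2 := by rw [Real.lt_sqrt] <;> norm_num
  have hbound : |c| + (d - 1) ≤ 3 * ‖e‖ := by
    rcases le_total 0 c with h0 | h0
    · rw [abs_of_nonneg h0]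
      have i1 : 0.4 * c ≤ c * β p := by nlinarith
      have i2 : 0.4 * (d - 1) ≤ (d - 1) * β q₁ := by nlinarith
      linarith [norm_nonneg e]
    · rw [abs_of_nonpos h0]
      have i1 : 0.4 * (-c) ≤ (-c) * α p := by nlinarith
      have i2 : 0.4 * (d - 1) ≤ (d - 1) * (-α q₁) := by nlinarith
      linarith [norm_nonneg e]
  calc ‖q₂ - q₁‖ = ‖c • p + (d - 1) • q₁ + e‖ := by rw [hΔ]
    _ ≤ ‖c • p‖ + ‖(d - 1) • q₁‖ + ‖e‖ := norm_add₃_le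
    _ = |c| + (d - 1) + ‖e‖ := by
      rw [norm_smul, norm_smul, h₁.left, h₁.right, Real.norm_eq_abs, Real.norm_eq_abs,
        abs_of_nonneg (by linarith : 0 ≤ d - 1), mul_one, mul_one]
    _ ≤ 4 * ‖e‖ := by linarith

lemma UnitPerp.eq_of_same_direction (hE : SquareBound E) {p q₁ q₂ y : E} {s₁ s₂ t₁ t₂ : ℝ}
    (h₁ : UnitPerp p q₁) (h₂ : UnitPerp p q₂) (e₁ : q₁ = s₁ • p + t₁ • y)
    (e₂ : q₂ = s₂ • p + t₂ • y) (ht₁ : 0 < t₁) (ht₂ : 0 < t₂) : q₁ = q₂ := by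
  rcases le_total t₁ t₂ with h | h
  · have := UnitPerp.norm_sub_le hE h₁ h₂ e₁ e₂ ht₁ h
    rw [sub_self, smul_zero, norm_zero, mul_zero] at this
    exact (sub_eq_zero.1 (norm_le_zero_iff.1 this)).symm
  · have := UnitPerp.norm_sub_le hE h₂ h₁ e₂ e₁ ht₂ h
    rw [sub_self, smul_zero, norm_zero, mul_zero] at this
    exact sub_eq_zero.1 (norm_le_zero_iff.1 this)

lemma UnitPerp.abs_apply_le (hE : SquareBound E) {p q : E} {ψ : E →L[ℝ] ℝ} (h : UnitPerp p q)
    (hψ : Supports ψ p) : |ψ q| ≤ √2 - 1 := by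
  have h1 := hψ.le_norm (p + q)
  have h2 := hψ.le_norm (p - q)
  rw [map_add, hψ.self, h.left, h.norm_add hE] at h1
  rw [map_sub, hψ.self, h.left, h.norm_sub hE] at h2
  exact abs_le.2 ⟨by linarith, by linarith⟩

/-- Testing on `t • k` as `t → 0⁺` gives `φ k ≤ ℓ k`; replacing `k` by `-k` forces `φ = ℓ`. -/
lemma hasFDerivAt_of_squeeze {g r : E → ℝ} {x : E} {φ ℓ : E →L[ℝ] ℝ}
    (h₁ : ∀ k, φ k ≤ g (x + k) - g x) (h₂ : ∀ k, g (x + k) - g x ≤ ℓ k + r k)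
    (hr : r =o[𝓝 0] fun k : E => k) : HasFDerivAt g ℓ x := by
  have hle : ∀ k, φ k - ℓ k ≤ 0 := by
    intro k
    have hlim : Tendsto (fun t : ℝ => t • k) (𝓝[>] 0) (𝓝 0) := by
      have : Continuous fun t : ℝ => t • k := by fun_prop
      simpa using (this.tendsto 0).mono_left nhdsWithin_le_nhds
    have h3 : (fun t : ℝ => r (t • k)) =o[𝓝[>] 0] fun t : ℝ => t := by
      refine (hr.comp_tendsto hlim).trans_isBigO ?_
      refine IsBigO.of_bound ‖k‖ (Eventually.of_forall fun t => ?_)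
      simp [norm_smul, mul_comm]
    have h4 := h3.tendsto_div_nhds_zero
    refine ge_of_tendsto h4 ?_
    filter_upwards [self_mem_nhdsWithin] with t ht
    have ht : 0 < t := ht
    rw [le_div_iff₀ ht]
    have h5 := (h₁ (t • k)).trans (h₂ (t • k))
    simp only [map_smul, smul_eq_mul] at h5
    linarith
  have heq : φ = ℓ := by
    ext k
    have h1 := hle k
    have h2 := hle (-k)
    simp only [map_neg] at h2
    linarith
  subst heq
  rw [hasFDerivAt_iff_isLittleO_nhds_zero]
  refine IsBigO.trans_isLittleO (IsBigO.of_bound 1 (Eventually.of_forall fun k => ?_)) hr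
  have h1 := h₁ k
  have h2 := h₂ k
  rw [one_mul, Real.norm_eq_abs, Real.norm_eq_abs, abs_of_nonneg (by linarith),
    abs_of_nonneg (by linarith)]
  linarith

/-- Differentiability of the norm at `p` is inherited by `p + q`. -/
lemma UnitPerp.exists_hasFDerivAt_norm_add (hE : SquareBound E) {p q : E} {ψ α : E →L[ℝ] ℝ}
    (h : UnitPerp p q) (hψ : HasFDerivAt (fun y : E => ‖y‖) ψ p) (hα : Supports α (p - q)) :
    ∃ κ : ℝ, κ ≠ 0 ∧ HasFDerivAt (fun y : E => ‖y‖) (κ • ψ - α) (p + q) := by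
  have hψp := Supports.of_hasFDerivAt hψ
  have hψq := h.abs_apply_le hE hψp
  have hαq := hα.abs_le_norm q
  rw [h.right] at hαq
  have hs : √2 < 1.5 := by rw [Real.sqrt_lt'] <;> norm_num
  have hs1 := one_lt_sqrt_two
  have hden : 0 < 1 + ψ q := by linarith [neg_le_of_abs_le hψq]
  have hnum : 0 < 2 * √2 + 2 * α q := by linarith [neg_le_of_abs_le hαq]
  refine ⟨(2 * √2 + 2 * α q) / (1 + ψ q), (div_pos hnum hden).ne', ?_⟩
  obtain ⟨β, hβ⟩ := exists_supports (p + q)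
  -- The displacement `k` is split as `T k + m k • q`, with `m` chosen so that `ψ (T k) = m k`: then
  -- `p + T k` and `(1 + m k) • q` have equal norms to first order, and the square bound loses only
  -- `ρ`.
  let m : E →L[ℝ] ℝ := (1 + ψ q)⁻¹ • ψ
  have hm : ∀ k, m k * (1 + ψ q) = ψ k := fun k => by
    simp only [m, smul_apply, smul_eq_mul]; field_simp
  let T : E →L[ℝ] E := ContinuousLinearMap.id ℝ E - m.smulRight q
  have hT : ∀ k, T k = k - m k • q := fun k => by simp [T]
  let ρ : E → ℝ := fun k => ‖p + T k‖ - ‖p‖ - ψ (T k)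
  have hρ : ρ =o[𝓝 0] fun k : E => k := by
    have h1 := (hasFDerivAt_iff_isLittleO_nhds_zero.1 hψ)
    have h2 : Tendsto T (𝓝 0) (𝓝 0) := by simpa using T.continuous.tendsto 0
    exact (h1.comp_tendsto h2).trans_isBigO (T.isBigO_id (𝓝 0))
  -- Below, a supporting functional at `p + q`; above, the square bound with the difference term
  -- estimated through `α`.
  refine hasFDerivAt_of_squeeze (φ := β) (r := fun k => 4 * √2 * |ρ k|) ?_ ?_ ?_
  · intro k
    have := hβ.le_norm (p + q + k)
    rw [map_add, hβ.self] at this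
    linarith
  · intro k
    have hψT : ψ (T k) = m k := by
      rw [hT, map_sub, map_smul, smul_eq_mul, ← hm k]; ring
    have hpT : ‖p + T k‖ = 1 + m k + ρ k := by
      simp only [ρ, hψT, h.left]; ring
    have hmax : max ‖p + T k‖ ‖(1 + m k) • q‖ ≤ 1 + m k + 2 * |ρ k| := by
      have h0 := norm_nonneg (p + T k)
      refine max_le ?_ ?_
      · rw [hpT]; linarith [le_abs_self (ρ k), abs_nonneg (ρ k)]
      · rw [norm_smul, h.right, mul_one, Real.norm_eq_abs]
        rw [hpT] at h0
        refine abs_le'.2 ⟨?_, ?_⟩ <;> linarith [le_abs_self (ρ k), abs_nonneg (ρ k)]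
    have h1 := hE (p + T k) ((1 + m k) • q)
    have e1 : p + T k + (1 + m k) • q = p + q + k := by
      rw [hT, add_smul, one_smul]; abel
    have e2 : p + T k - (1 + m k) • q = (p - q) + (k - (2 * m k) • q) := by
      rw [hT, add_smul, one_smul, two_mul, add_smul]; abel
    rw [e1, e2] at h1
    have h2 := hα.le_norm ((p - q) + (k - (2 * m k) • q))
    rw [map_add, hα.self, h.norm_sub hE, map_sub, map_smul, smul_eq_mul] at h2
    have h3 : 2 * √2 * max ‖p + T k‖ ‖(1 + m k) • q‖ ≤ 2 * √2 * (1 + m k + 2 * |ρ k|) := by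
      gcongr
    have h4 : (2 * √2 + 2 * α q) / (1 + ψ q) * ψ k = (2 * √2 + 2 * α q) * m k := by
      rw [← hm k]; field_simp
    simp only [sub_apply, smul_apply, smul_eq_mul]
    rw [h4, h.norm_add hE]
    linarith
  · exact (hρ.abs_left).const_mul_left _

end Support

/-! ### Partners of a unit vector form a plane section of the sphere. -/

section Planar

variable {E : Type*} [NormedAddCommGroup E] [NormedSpace ℝ E]

/-- At a point of differentiability of the norm of a space of dimension at least three, isosceles
orthogonality implies Birkhoff orthogonality. -/
lemma UnitPerp.apply_eq_zero_of_hasFDerivAt (hE : SquareBound E) {p q : E} {ψ : E →L[ℝ] ℝ}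
    (hψ : HasFDerivAt (fun y : E => ‖y‖) ψ p) (hrank : 1 < Module.rank ℝ ψ.ker)
    (h : UnitPerp p q) : ψ q = 0 := by
  have hp := h.left
  have hsup := Supports.of_hasFDerivAt hψ
  have hψp : ψ p = 1 := by rw [hsup.self, hp]
  have hs : √2 < 1.5 := by rw [Real.sqrt_lt'] <;> norm_num
  -- `z y` is the partner of `p` in the direction `y` modulo `p`; the values at `y = 0` are dummies.
  have hex : ∀ y : ψ.ker, ∃ (z : E) (t : ℝ), y ≠ 0 →
      UnitPerp p z ∧ 0 < t ∧ z = ψ z • p + t • (y : E) := by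
    intro y
    by_cases hy : y = 0
    · exact ⟨0, 0, fun h => absurd hy h⟩
    have hyψ : ψ (y : E) = 0 := y.2
    obtain ⟨s, t, ht, hz⟩ := exists_unitPerp (y := (y : E)) hp (by
      rintro c hc
      rw [hc, map_smul, hψp, smul_eq_mul, mul_one] at hyψ
      rw [hyψ, zero_smul] at hc
      exact hy (Subtype.ext hc))
    refine ⟨s • p + t • (y : E), t, fun _ => ⟨hz, ht, ?_⟩⟩
    simp [hψp, hyψ]
  choose z t hzt using hex
  have hbound : ∀ y : ψ.ker, y ≠ 0 → t y * ‖y‖ ≤ 2 := by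
    intro y hy
    obtain ⟨hz, ht, e⟩ := hzt y hy
    have e1 : t y • (y : E) = z y - ψ (z y) • p := by rw [eq_sub_iff_add_eq, add_comm]; exact e.symm
    have e2 : t y * ‖y‖ = ‖t y • (y : E)‖ := by
      rw [norm_smul, Real.norm_eq_abs, abs_of_pos ht]; rfl
    rw [e2, e1]
    have h1 := hz.abs_apply_le hE hsup
    calc ‖z y - ψ (z y) • p‖ ≤ ‖z y‖ + ‖ψ (z y) • p‖ := _root_.norm_sub_le _ _
      _ ≤ 1 + |ψ (z y)| := by rw [norm_smul, hp, hz.right, Real.norm_eq_abs, mul_one]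
      _ ≤ 2 := by linarith
  have hlip : ∀ y y₀ : ψ.ker, y ≠ 0 → y₀ ≠ 0 →
      ‖z y - z y₀‖ ≤ 4 * max (t y) (t y₀) * ‖y - y₀‖ := by
    have aux : ∀ y y₀ : ψ.ker, y ≠ 0 → y₀ ≠ 0 → t y₀ ≤ t y →
        ‖z y - z y₀‖ ≤ 4 * t y * ‖y - y₀‖ := by
      intro y y₀ hy hy₀ hle
      obtain ⟨hz, ht, e⟩ := hzt y hy
      obtain ⟨hz₀, ht₀, e₀⟩ := hzt y₀ hy₀
      have := UnitPerp.norm_sub_le hE hz₀ hz e₀ e ht₀ hle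
      rw [norm_smul, Real.norm_eq_abs, abs_of_pos ht, ← mul_assoc] at this
      exact this
    intro y y₀ hy hy₀
    rcases le_total (t y₀) (t y) with hle | hle
    · rw [max_eq_left hle]; exact aux y y₀ hy hy₀ hle
    · rw [max_eq_right hle, norm_sub_rev, norm_sub_rev y y₀]; exact aux y₀ y hy₀ hy hle
  have hO : ∀ y₀ : ψ.ker, y₀ ≠ 0 → (fun y => z y - z y₀) =O[𝓝 y₀] fun y => y - y₀ := by
    intro y₀ hy₀
    have hn0 : 0 < ‖y₀‖ := norm_pos_iff.2 hy₀
    refine IsBigO.of_bound (16 / ‖y₀‖) ?_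
    have hev : ∀ᶠ y in 𝓝 y₀, ‖y₀‖ / 2 < ‖y‖ :=
      (continuous_norm.tendsto y₀).eventually_const_lt (half_lt_self hn0)
    filter_upwards [hev] with y hy
    have hy0 : y ≠ 0 := norm_pos_iff.1 (lt_trans (half_pos hn0) hy)
    have ht : ∀ y' : ψ.ker, y' ≠ 0 → ‖y₀‖ / 2 < ‖y'‖ → t y' ≤ 4 / ‖y₀‖ := by
      intro y' hy' hlt
      rw [le_div_iff₀ hn0]
      have := hbound y' hy'
      nlinarith [(hzt y' hy').2.1]
    refine (hlip y y₀ hy0 hy₀).trans (mul_le_mul_of_nonneg_right ?_ (norm_nonneg _))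
    have := max_le (ht y hy0 hy) (ht y₀ hy₀ (half_lt_self hn0))
    calc 4 * max (t y) (t y₀) ≤ 4 * (4 / ‖y₀‖) := by gcongr
      _ = 16 / ‖y₀‖ := by ring
  have hcont : ∀ y₀ : ψ.ker, y₀ ≠ 0 → Tendsto (fun y => z y - z y₀) (𝓝 y₀) (𝓝 0) := by
    intro y₀ hy₀
    refine (hO y₀ hy₀).trans_tendsto ?_
    have : Continuous fun y : ψ.ker => y - y₀ := by fun_prop
    simpa using this.tendsto y₀
  have hne : ∀ y₀ : ψ.ker, y₀ ≠ 0 → ∀ᶠ y in 𝓝 y₀, y ≠ 0 := fun y₀ hy₀ =>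
    isOpen_ne.mem_nhds hy₀
  have hder : ∀ y₀ : ψ.ker, y₀ ≠ 0 →
      HasFDerivAt (fun y => ψ (z y)) (0 : ψ.ker →L[ℝ] ℝ) y₀ := by
    intro y₀ hy₀
    -- Applied to `-z y₀` with an arbitrary support, then to `z y₀`: the derivatives at `p - z y₀`
    -- and `p + z y₀` become `α` and `κ • ψ - α`.
    obtain ⟨hz₀, -, -⟩ := hzt y₀ hy₀
    obtain ⟨α₀, hα₀⟩ := exists_supports (p - -z y₀)
    obtain ⟨κ₀, -, hA⟩ := hz₀.neg_right.exists_hasFDerivAt_norm_add hE hψ hα₀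
    generalize κ₀ • ψ - α₀ = α at hA
    rw [← sub_eq_add_neg] at hA
    obtain ⟨κ, hκ, hB⟩ :=
      hz₀.exists_hasFDerivAt_norm_add hE hψ (Supports.of_hasFDerivAt hA)
    have hB1 := ((hasFDerivAt_iff_isLittleO_nhds_zero.1 hB).comp_tendsto
      (hcont y₀ hy₀)).trans_isBigO (hO y₀ hy₀)
    have hA1 := ((hasFDerivAt_iff_isLittleO_nhds_zero.1 hA).comp_tendsto
      (by simpa using (hcont y₀ hy₀).neg)).trans_isBigO (hO y₀ hy₀).neg_left
    rw [hasFDerivAt_iff_isLittleO]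
    -- Both norms stay equal to `√2`, so subtracting the two expansions cancels `α` and leaves `κ *
    -- ψ (z y - z y₀) = o(y - y₀)`.
    refine ((hA1.sub hB1).const_mul_left κ⁻¹).congr' ?_ EventuallyEq.rfl
    filter_upwards [hne y₀ hy₀] with y hy
    obtain ⟨hz, -, -⟩ := hzt y hy
    have e1 : p + z y₀ + (z y - z y₀) = p + z y := by abel
    have e2 : p - z y₀ + -(z y - z y₀) = p - z y := by abel
    simp only [Function.comp, e1, e2, hz.norm_add hE, hz₀.norm_add hE, hz.norm_sub hE,
      hz₀.norm_sub hE, map_neg, map_sub, sub_apply, smul_apply, smul_eq_mul, zero_apply]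
    field_simp
    ring
  -- Dimension three enters here: a line minus the origin would be disconnected.
  have hconn : IsPreconnected ({0}ᶜ : Set ψ.ker) :=
    (isConnected_compl_singleton_of_one_lt_rank hrank 0).isPreconnected
  have hconst : ∀ y₁ y₂ : ψ.ker, y₁ ≠ 0 → y₂ ≠ 0 → ψ (z y₁) = ψ (z y₂) := by
    intro y₁ y₂ h₁ h₂
    exact isOpen_compl_singleton.is_const_of_fderiv_eq_zero (𝕜 := ℝ)
      (f := fun y : ψ.ker => ψ (z y)) hconn
      (fun y hy => (hder y hy).differentiableAt.differentiableWithinAt)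
      (fun y hy => (hder y hy).fderiv) h₁ h₂
  have hzero : ∀ y : ψ.ker, y ≠ 0 → ψ (z y) = 0 := by
    intro y hy
    obtain ⟨hz, ht, e⟩ := hzt y hy
    obtain ⟨hz', ht', e'⟩ := hzt (-y) (neg_ne_zero.2 hy)
    -- By uniqueness `z (-y) = -z y`, so the constant value equals its own negative.
    have e'' : -z y = (-ψ (z y)) • p + t y • ((-y : ψ.ker) : E) := by
      conv_lhs => rw [e]
      simp only [Submodule.coe_neg, smul_neg, neg_smul, neg_add]
    have h1 := UnitPerp.eq_of_same_direction hE hz.neg_right hz' e'' e' ht ht'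
    have h2 := hconst y (-y) hy (neg_ne_zero.2 hy)
    rw [← h1, map_neg] at h2
    linarith
  have hy : ψ (q - ψ q • p) = 0 := by simp [hψp]
  let y : ψ.ker := ⟨q - ψ q • p, hy⟩
  have hy0 : y ≠ 0 := by
    intro h0
    have h1 : q - ψ q • p = 0 := congrArg Subtype.val h0
    have h2 := h.right
    rw [sub_eq_zero.1 h1, norm_smul, hp, mul_one, Real.norm_eq_abs] at h2
    linarith [h.abs_apply_le hE hsup]
  obtain ⟨hz, ht, e⟩ := hzt y hy0
  have e' : q = ψ q • p + (1 : ℝ) • (y : E) := by simp [y]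
  rw [UnitPerp.eq_of_same_direction hE h hz e' e one_pos ht]
  exact hzero y hy0

/-- Every unit vector has a supporting hyperplane that contains exactly the unit vectors isosceles
orthogonal to it. -/
lemma exists_supports_unitPerp_iff (hE : SquareBound E) (hdim : Module.finrank ℝ E = 3) {x : E}
    (hx : ‖x‖ = 1) :
    ∃ ψ : E →L[ℝ] ℝ, Supports ψ x ∧ ∀ q, ‖q‖ = 1 → (UnitPerp x q ↔ ψ q = 0) := by
  have : FiniteDimensional ℝ E := FiniteDimensional.of_finrank_pos (by omega)
  have hsmooth : ∀ (p : E) (ψ : E →L[ℝ] ℝ), ‖p‖ = 1 → HasFDerivAt (fun y : E => ‖y‖) ψ p →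
      ∀ q, ‖q‖ = 1 → ψ q = 0 → UnitPerp p q := by
    intro p ψ hp hψ q hq hψq
    have hψp : ψ p = 1 := by rw [(Supports.of_hasFDerivAt hψ).self, hp]
    obtain ⟨s, t, ht, hst⟩ := exists_unitPerp (p := p) (y := q) hp (by
      rintro c rfl
      rw [map_smul, hψp, smul_eq_mul, mul_one] at hψq
      simp [hψq] at hq)
    have hrank : 1 < Module.rank ℝ ψ.ker := by
      have h1 := ψ.toLinearMap.finrank_range_add_finrank_ker
      have h2 : Module.finrank ℝ ψ.range ≤ 1 := by
        simpa using Submodule.finrank_le ψ.range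
      rw [← Module.finrank_eq_rank]
      have h3 : 1 < Module.finrank ℝ ψ.ker := by
        change Module.finrank ℝ ψ.range + Module.finrank ℝ ψ.ker = _ at h1
        omega
      exact_mod_cast h3
    have h0 := hst.apply_eq_zero_of_hasFDerivAt hE hψ hrank
    simp only [map_add, map_smul, hψp, hψq, smul_eq_mul, mul_one, mul_zero, add_zero] at h0
    subst h0
    have h1 := hst.right
    rw [zero_smul, zero_add, norm_smul, hq, mul_one, Real.norm_eq_abs, abs_of_pos ht] at h1
    subst h1
    simpa using hst
  -- Smooth points are dense; `ψ` is a limit of derivatives at smooth unit vectors tending to `x`.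
  obtain ⟨u, hu, hux⟩ := mem_closure_iff_seq_limit.1 ((dense_differentiableAt_norm (E := E)) x)
  have hu0 : ∀ n, u n ≠ 0 := fun n h0 => by
    have := hu n
    rw [h0] at this
    have : Nontrivial E := ⟨x, 0, by rintro rfl; simp at hx⟩
    exact not_differentiableAt_norm_zero E ‹_›
  let p : ℕ → E := fun n => ‖u n‖⁻¹ • u n
  have hp : ∀ n, ‖p n‖ = 1 := fun n => norm_smul_inv_norm (𝕜 := ℝ) (hu0 n)
  have hpx : Tendsto p atTop (𝓝 x) := by
    have := (hux.norm.inv₀ (by rw [hx]; exact one_ne_zero)).smul hux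
    simpa [hx] using this
  have hpd : ∀ n, DifferentiableAt ℝ (fun y : E => ‖y‖) (p n) := fun n =>
    (differentiableAt_norm_smul (inv_ne_zero (norm_ne_zero_iff.2 (hu0 n)))).1 (hu n)
  let Ψ : ℕ → E →L[ℝ] ℝ := fun n => fderiv ℝ (fun y : E => ‖y‖) (p n)
  have hΨ : ∀ n, HasFDerivAt (fun y : E => ‖y‖) (Ψ n) (p n) := fun n => (hpd n).hasFDerivAt
  have hΨs : ∀ n, Supports (Ψ n) (p n) := fun n => Supports.of_hasFDerivAt (hΨ n)
  obtain ⟨ψ, -, φ, hφ, hlim⟩ := (isCompact_closedBall (0 : E →L[ℝ] ℝ) 1).tendsto_subseq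
    (x := Ψ) (fun n => by simpa using (hΨs n).norm_le_one)
  have hpx' := hpx.comp hφ.tendsto_atTop
  have happ : ∀ (w : ℕ → E) (w₀ : E), Tendsto w atTop (𝓝 w₀) →
      Tendsto (fun n => Ψ (φ n) (w n)) atTop (𝓝 (ψ w₀)) := fun w w₀ hw =>
    (isBoundedBilinearMap_apply.continuous.tendsto (ψ, w₀)).comp (hlim.prodMk_nhds hw)
  have hψx : ψ x = 1 := by
    refine tendsto_nhds_unique (happ _ _ hpx') ?_
    simp [(hΨs _).self, hp]
  have hψs : Supports ψ x := by
    refine ⟨fun y => ?_, by rw [hψx, hx]⟩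
    exact le_of_tendsto (happ _ _ tendsto_const_nhds)
      (Eventually.of_forall fun n => (hΨs (φ n)).le_norm y)
  have hmp : ∀ q, ‖q‖ = 1 → ψ q = 0 → UnitPerp x q := by
    intro q hq hψq
    -- `q` is projected along `p (φ n)` to the kernel of the approximating derivative, where the
    -- smooth case applies.
    let w : ℕ → E := fun n => q - Ψ (φ n) q • p (φ n)
    have hw : Tendsto w atTop (𝓝 q) := by
      have h1 := (happ _ _ (tendsto_const_nhds (x := q))).smul hpx'
      simpa [hψq] using (tendsto_const_nhds (x := q)).sub h1
    have hw0 : ∀ n, Ψ (φ n) (w n) = 0 := fun n => by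
      simp [w, (hΨs _).self, hp]
    have hwn : Tendsto (fun n => ‖w n‖⁻¹ • w n) atTop (𝓝 q) := by
      have := (hw.norm.inv₀ (by rw [hq]; exact one_ne_zero)).smul hw
      simpa [hq] using this
    have hev : ∀ᶠ n in atTop, ‖p (φ n) + ‖w n‖⁻¹ • w n‖ = ‖p (φ n) - ‖w n‖⁻¹ • w n‖ := by
      have h1 : ∀ᶠ n in atTop, w n ≠ 0 :=
        hw.eventually_ne (by rintro rfl; simp at hq)
      filter_upwards [h1] with n hn
      exact (hsmooth _ _ (hp _) (hΨ _) _ (norm_smul_inv_norm (𝕜 := ℝ) hn)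
        (by rw [map_smul, hw0, smul_zero])).iso
    exact ⟨hx, hq, tendsto_nhds_unique ((hpx'.add hwn).norm.congr' hev) (hpx'.sub hwn).norm⟩
  refine ⟨ψ, hψs, fun q hq => ⟨fun h => ?_, hmp q hq⟩⟩
  -- The normalized kernel part of `q` is also a partner of `x` in the same direction modulo `x`, so
  -- it equals `q`.
  set y := q - ψ q • x with hy
  have hψy : ψ y = 0 := by simp [hy, hψx]
  have hy0 : y ≠ 0 := by
    intro h0
    rw [hy, sub_eq_zero] at h0
    have h2 := h.right
    rw [h0, norm_smul, hx, mul_one, Real.norm_eq_abs] at h2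
    have hs : √2 < 1.5 := by rw [Real.sqrt_lt'] <;> norm_num
    linarith [h.abs_apply_le hE hψs]
  have h1 : UnitPerp x (‖y‖⁻¹ • y) :=
    hmp _ (norm_smul_inv_norm (𝕜 := ℝ) hy0) (by rw [map_smul, hψy, smul_zero])
  have h2 := UnitPerp.eq_of_same_direction hE h h1
    (show q = ψ q • x + (1 : ℝ) • y by simp [hy])
    (show ‖y‖⁻¹ • y = (0 : ℝ) • x + ‖y‖⁻¹ • y by simp) one_pos
    (inv_pos.2 (norm_pos_iff.2 hy0))
  rw [h2, map_smul, hψy, smul_zero]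

end Planar

/-! ### Symmetric linear orthogonality relations in coordinates. -/

section Polarity

/-- Here `(1, f s, h t)` are the coefficients of the functional attached to `(1, s, t)`, and `sym`
is symmetry of orthogonality. Taking `s, t = ±1` links `f` and `h`; taking `t = 1` gives `f (f s *
x) = f x * s`, so `f` is an involution and then multiplicative. -/
lemma map_mul_of_symmetric_polarity {f h : ℝ → ℝ}
    (sym : ∀ s t β γ, 1 + f s * β + h t * γ = 0 → 1 + f β * s + h γ * t = 0)
    (f₁ : f 1 = 1) (h₁ : h 1 = 1) (f₁' : f (-1) = -1) (h₁' : h (-1) = -1) :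
    (∀ x, f (x + 1) = 1 + h x) ∧ (∀ x, h (x + 1) = 1 + f x) ∧ (∀ x, f (-x) = -f x) ∧
      ∀ x y, f (x * y) = f x * f y := by
  have a₁ : ∀ x, h (-1 - x) = -1 - f x := fun x => by
    have := sym 1 1 x (-1 - x) (by rw [f₁, h₁]; ring)
    linarith
  have a₂ : ∀ x, h (x + 1) = 1 + f x := fun x => by
    have := sym 1 (-1) x (x + 1) (by rw [f₁, h₁']; ring)
    linarith
  have a₃ : ∀ x, h (x - 1) = f x - 1 := fun x => by
    have := sym (-1) 1 x (x - 1) (by rw [f₁', h₁]; ring)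
    linarith
  have a₄ : ∀ x, h (1 - x) = 1 - f x := fun x => by
    have := sym (-1) (-1) x (1 - x) (by rw [f₁', h₁']; ring)
    linarith
  have fodd : ∀ x, f (-x) = -f x := fun x => by
    have e1 := a₂ (-x)
    have e2 := a₄ x
    rw [show 1 - x = -x + 1 by ring] at e2
    linarith
  have fshift : ∀ x, f (x + 1) = 1 + h x := fun x => by
    have := a₃ (x + 1)
    rw [add_sub_cancel_right] at this
    linarith
  have fcomp : ∀ s x, f (f s * x) = f x * s := fun s x => by
    have e := sym s 1 x (-1 - f s * x) (by rw [h₁]; ring)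
    rw [a₁] at e
    linarith
  have finv : ∀ s, f (f s) = s := fun s => by
    have := fcomp s 1
    rwa [mul_one, f₁, one_mul] at this
  refine ⟨fshift, a₂, fodd, fun x y => ?_⟩
  have := fcomp (f x) y
  rw [finv] at this
  rw [this, mul_comm]

/-- Normalized coefficients of a symmetric linear orthogonality relation are trivial. -/
lemma eq_id_of_symmetric_polarity {f h : ℝ → ℝ}
    (sym : ∀ s t β γ, 1 + f s * β + h t * γ = 0 → 1 + f β * s + h γ * t = 0)
    (f₁ : f 1 = 1) (h₁ : h 1 = 1) (f₁' : f (-1) = -1) (h₁' : h (-1) = -1) (x : ℝ) :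
    f x = x ∧ h x = x := by
  obtain ⟨fs, hs, fodd, fmul⟩ := map_mul_of_symmetric_polarity sym f₁ h₁ f₁' h₁'
  have f₂ : f 2 = 2 := by
    have := fs 1
    rw [h₁] at this
    norm_num at this
    exact this
  -- Computing `f (2 * x + 2)` by doubling and by two unit shifts identifies `h` with `f`.
  have hfe : ∀ x, h x = f x := fun x => by
    have e1 := fmul 2 (x + 1)
    have e2 := fs (2 * x + 1)
    rw [hs, fmul 2 x, f₂] at e2
    rw [f₂, fs, show 2 * (x + 1) = 2 * x + 1 + 1 by ring] at e1
    linarith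
  have f₀ : f 0 = 0 := by
    have := fodd 0
    rw [neg_zero] at this
    linarith
  have fadd : ∀ x y, f (x + y) = f x + f y := fun x y => by
    by_cases hy : y = 0
    · simp [hy, f₀]
    · have e1 : x + y = y * (x / y + 1) := by field_simp
      have e2 : f x = f y * f (x / y) := by rw [← fmul, mul_div_cancel₀ _ hy]
      rw [e1, fmul, fs, hfe, e2]; ring
  let F : ℝ →+* ℝ :=
    { toFun := f, map_one' := f₁, map_mul' := fmul, map_zero' := f₀, map_add' := fadd }
  have hF : ∀ x, f x = x := fun x => by
    have : F = RingHom.id ℝ := Subsingleton.elim _ _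
    exact congrArg (fun G : ℝ →+* ℝ => G x) this
  exact ⟨hF x, by rw [hfe, hF]⟩

variable {V : Type*} [AddCommGroup V] [Module ℝ V]

/-- A symmetric orthogonality relation that is linear and anisotropic is given, on the span of an
orthogonal triple with orthogonal diagonals, by the standard inner product. -/
lemma inner_eq_zero_of_polarity {Φ : V → V →ₗ[ℝ] ℝ} (hself : ∀ x, x ≠ 0 → Φ x x ≠ 0)
    (hsymm : ∀ x y, Φ x y = 0 → Φ y x = 0) {p q r : V} (hp : p ≠ 0)
    (hpq : Φ p q = 0) (hpr : Φ p r = 0) (hqr : Φ q r = 0)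
    (dpq : Φ (p + q) (p - q) = 0) (dpr : Φ (p + r) (p - r) = 0) {a b c a' b' c' : ℝ}
    (h : Φ (a • p + b • q + c • r) (a' • p + b' • q + c' • r) = 0) :
    a * a' + b * b' + c * c' = 0 := by
  have hadd : ∀ x y z, Φ x z = 0 → Φ y z = 0 → Φ (x + y) z = 0 := fun x y z h1 h2 =>
    hsymm _ _ (by rw [map_add, hsymm _ _ h1, hsymm _ _ h2, add_zero])
  have hsmul : ∀ (k : ℝ) x z, Φ x z = 0 → Φ (k • x) z = 0 := fun k x z h1 =>
    hsymm _ _ (by rw [map_smul, hsymm _ _ h1, smul_zero])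
  have hvp : ∀ s t : ℝ, Φ (p + s • q + t • r) p ≠ 0 := fun s t h0 => by
    have h1 := hsymm _ _ h0
    simp only [map_add, map_smul, hpq, hpr, smul_zero, add_zero] at h1
    exact hself p hp h1
  let f : ℝ → ℝ := fun s => Φ (p + s • q + (0 : ℝ) • r) q / Φ (p + s • q + (0 : ℝ) • r) p
  let g : ℝ → ℝ := fun t => Φ (p + (0 : ℝ) • q + t • r) r / Φ (p + (0 : ℝ) • q + t • r) p
  -- The ratio does not depend on `t`, because `r` is orthogonal to `f s • p - q` and orthogonality
  -- is additive in its first argument.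
  have hf : ∀ s t : ℝ, Φ (p + s • q + t • r) q = f s * Φ (p + s • q + t • r) p := by
    intro s t
    have h1 : Φ (p + s • q + (0 : ℝ) • r) (f s • p - q) = 0 := by
      simp only [map_sub, map_smul, smul_eq_mul, f]
      rw [div_mul_cancel₀ _ (hvp s 0), sub_self]
    have h2 : Φ r (f s • p - q) = 0 := by
      rw [map_sub, map_smul, hsymm _ _ hpr, hsymm _ _ hqr, smul_zero, sub_zero]
    have h3 := hadd _ _ _ h1 (hsmul t _ _ h2)
    rw [zero_smul, add_zero, map_sub, map_smul, smul_eq_mul, sub_eq_zero] at h3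
    exact h3.symm
  have hg : ∀ s t : ℝ, Φ (p + s • q + t • r) r = g t * Φ (p + s • q + t • r) p := by
    intro s t
    have h1 : Φ (p + (0 : ℝ) • q + t • r) (g t • p - r) = 0 := by
      simp only [map_sub, map_smul, smul_eq_mul, g]
      rw [div_mul_cancel₀ _ (hvp 0 t), sub_self]
    have h2 : Φ q (g t • p - r) = 0 := by
      rw [map_sub, map_smul, hsymm _ _ hpq, hqr, smul_zero, sub_zero]
    have h3 := hadd _ _ _ h1 (hsmul s _ _ h2)
    rw [zero_smul, add_zero, add_right_comm, map_sub, map_smul, smul_eq_mul, sub_eq_zero] at h3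
    exact h3.symm
  have key : ∀ s t α β γ : ℝ, Φ (p + s • q + t • r) (α • p + β • q + γ • r) = 0 ↔
      α + f s * β + g t * γ = 0 := by
    intro s t α β γ
    have : Φ (p + s • q + t • r) (α • p + β • q + γ • r) =
        (α + f s * β + g t * γ) * Φ (p + s • q + t • r) p := by
      simp only [map_add, map_smul, smul_eq_mul, hf s t, hg s t]; ring
    rw [this, mul_eq_zero, or_iff_left (hvp s t)]
  have sym : ∀ s t β γ, 1 + f s * β + g t * γ = 0 → 1 + f β * s + g γ * t = 0 := by
    intro s t β γ h1
    rw [← key] at h1 ⊢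
    rw [one_smul] at h1 ⊢
    exact hsymm _ _ h1
  have f₁ : f 1 = 1 := by
    have := (key 1 0 1 (-1) 0).1 (by simpa [sub_eq_add_neg] using dpq)
    linarith
  have f₁' : f (-1) = -1 := by
    have := (key (-1) 0 1 1 0).1 (by simpa [sub_eq_add_neg] using hsymm _ _ dpq)
    linarith
  have g₁ : g 1 = 1 := by
    have := (key 0 1 1 0 (-1)).1 (by simpa [sub_eq_add_neg] using dpr)
    linarith
  have g₁' : g (-1) = -1 := by
    have := (key 0 (-1) 1 0 1).1 (by simpa [sub_eq_add_neg] using hsymm _ _ dpr)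
    linarith
  have hid := eq_id_of_symmetric_polarity sym f₁ g₁ f₁' g₁'
  have key' : ∀ s t α β γ : ℝ, Φ (p + s • q + t • r) (α • p + β • q + γ • r) = 0 →
      α + s * β + t * γ = 0 := fun s t α β γ h1 => by
    have := (key s t α β γ).1 h1
    rwa [(hid s).1, (hid t).2] at this
  have hne : ∀ a b c a' b' c' : ℝ, a ≠ 0 →
      Φ (a • p + b • q + c • r) (a' • p + b' • q + c' • r) = 0 →
      a * a' + b * b' + c * c' = 0 := by
    intro a b c a' b' c' ha h1
    have h2 := hsmul a⁻¹ _ _ h1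
    rw [smul_add, smul_add, smul_smul, smul_smul, smul_smul, inv_mul_cancel₀ ha, one_smul] at h2
    have h3 := key' _ _ _ _ _ h2
    have h4 : a * (a' + a⁻¹ * b * b' + a⁻¹ * c * c') = 0 := by rw [h3, mul_zero]
    rw [← h4]; field_simp
  by_cases ha : a = 0
  · by_cases ha' : a' = 0
    -- When both `p`-coordinates vanish, adding `p` to the first vector preserves orthogonality and
    -- makes its coordinate `1`.
    · subst ha ha'
      have h1 : Φ p ((0 : ℝ) • p + b' • q + c' • r) = 0 := by
        simp only [map_add, map_smul, hpq, hpr, zero_smul, map_zero, smul_zero, add_zero]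
      have h2 := hadd _ _ _ h1 h
      rw [zero_smul ℝ p, zero_add, ← add_assoc, ← zero_smul ℝ p] at h2
      have h3 := key' _ _ _ _ _ h2
      linarith
    · have := hne _ _ _ _ _ _ ha' (hsymm _ _ h)
      linarith
  · exact hne _ _ _ _ _ _ ha h

end Polarity

/-! ### The norm is Euclidean. -/

section Euclidean

variable {E : Type*} [NormedAddCommGroup E] [NormedSpace ℝ E]

lemma UnitPerp.smul_add_smul_sub (hE : SquareBound E) {x y : E} (h : UnitPerp x y) :
    UnitPerp ((√2)⁻¹ • (x + y)) ((√2)⁻¹ • (x - y)) := by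
  have hs : 0 < √2 := by positivity
  refine ⟨?_, ?_, ?_⟩
  · rw [norm_smul, h.norm_add hE, norm_inv, Real.norm_eq_abs, abs_of_pos hs,
      inv_mul_cancel₀ hs.ne']
  · rw [norm_smul, h.norm_sub hE, norm_inv, Real.norm_eq_abs, abs_of_pos hs,
      inv_mul_cancel₀ hs.ne']
  · have e1 : x + y + (x - y) = (2 : ℝ) • x := by rw [two_smul]; abel
    have e2 : x + y - (x - y) = (2 : ℝ) • y := by rw [two_smul]; abel
    rw [← smul_add, ← smul_sub, e1, e2]
    simp only [norm_smul, h.left, h.right]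

lemma exists_polarity (hE : SquareBound E) (hdim : Module.finrank ℝ E = 3) :
    ∃ Φ : E → E →ₗ[ℝ] ℝ, (∀ x, x ≠ 0 → Φ x x ≠ 0) ∧ (∀ x y, Φ x y = 0 → Φ y x = 0) ∧
      ∀ x y, x ≠ 0 → y ≠ 0 → (Φ x y = 0 ↔ UnitPerp (‖x‖⁻¹ • x) (‖y‖⁻¹ • y)) := by
  have hex : ∀ x : E, ∃ φ : E →ₗ[ℝ] ℝ, (x = 0 → φ = 0) ∧ (x ≠ 0 → φ x ≠ 0 ∧
      ∀ y, y ≠ 0 → (φ y = 0 ↔ UnitPerp (‖x‖⁻¹ • x) (‖y‖⁻¹ • y))) := by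
    intro x
    by_cases hx : x = 0
    -- The zero functional at `0` keeps the relation symmetric when a vector vanishes.
    · exact ⟨0, fun _ => rfl, fun h => absurd hx h⟩
    have hx1 : ‖‖x‖⁻¹ • x‖ = 1 := norm_smul_inv_norm (𝕜 := ℝ) hx
    obtain ⟨ψ, hψ, hiff⟩ := exists_supports_unitPerp_iff hE hdim hx1
    refine ⟨ψ.toLinearMap, fun h => absurd h hx, fun _ => ⟨fun h0 => ?_, fun y hy => ?_⟩⟩
    · have h1 := hψ.self
      have h0' : ψ x = 0 := h0
      rw [map_smul, h0', smul_zero, hx1] at h1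
      exact zero_ne_one h1
    · have hy1 : ‖‖y‖⁻¹ • y‖ = 1 := norm_smul_inv_norm (𝕜 := ℝ) hy
      rw [hiff _ hy1, map_smul, smul_eq_mul, mul_eq_zero,
        or_iff_right (inv_ne_zero (norm_ne_zero_iff.2 hy))]
      rfl
  choose Φ hΦ0 hΦ using hex
  refine ⟨Φ, fun x hx => (hΦ x hx).1, fun x y h => ?_, fun x y hx hy => (hΦ x hx).2 y hy⟩
  by_cases hx : x = 0
  · rw [hx, map_zero]
  by_cases hy : y = 0
  · rw [hΦ0 y hy]; rfl
  exact ((hΦ y hy).2 x hx).2 (((hΦ x hx).2 y hy).1 h).symm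

lemma exists_norm_eq_one_of_two_functionals (hdim : Module.finrank ℝ E = 3)
    (φ₁ φ₂ : E →ₗ[ℝ] ℝ) : ∃ z : E, ‖z‖ = 1 ∧ φ₁ z = 0 ∧ φ₂ z = 0 := by
  have : FiniteDimensional ℝ E := FiniteDimensional.of_finrank_pos (by omega)
  have h1 : (φ₁.prod φ₂).ker ≠ ⊥ := LinearMap.ker_ne_bot_of_finrank_lt (by simp [hdim])
  obtain ⟨z, hz, hz0⟩ := Submodule.exists_mem_ne_zero_of_ne_bot h1
  have hz' : φ₁ z = 0 ∧ φ₂ z = 0 := by simpa using hz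
  exact ⟨‖z‖⁻¹ • z, norm_smul_inv_norm (𝕜 := ℝ) hz0, by rw [map_smul, hz'.1, smul_zero],
    by rw [map_smul, hz'.2, smul_zero]⟩

lemma parallelogram_of_finrank_eq_three (hE : SquareBound E) (hdim : Module.finrank ℝ E = 3)
    (x y : E) : ‖x + y‖ * ‖x + y‖ + ‖x - y‖ * ‖x - y‖ = 2 * (‖x‖ * ‖x‖ + ‖y‖ * ‖y‖) := by
  have : FiniteDimensional ℝ E := FiniteDimensional.of_finrank_pos (by omega)
  obtain ⟨Φ, hself, hsymm, hiff⟩ := exists_polarity hE hdim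
  have hne : ∀ {x : E}, ‖x‖ = 1 → x ≠ 0 := by rintro x hx rfl; simp at hx
  have hperp : ∀ {x y : E}, ‖x‖ = 1 → ‖y‖ = 1 → Φ x y = 0 → UnitPerp x y := by
    intro x y hx hy h
    simpa [hx, hy] using (hiff x y (hne hx) (hne hy)).1 h
  have hdiag : ∀ {x y : E}, ‖x‖ = 1 → ‖y‖ = 1 → Φ x y = 0 → Φ (x + y) (x - y) = 0 := by
    intro x y hx hy h
    have h1 := hperp hx hy h
    have hs : 0 < √2 := by positivity
    have h2 : x + y ≠ 0 := norm_ne_zero_iff.1 (by rw [h1.norm_add hE]; exact hs.ne')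
    have h3 : x - y ≠ 0 := norm_ne_zero_iff.1 (by rw [h1.norm_sub hE]; exact hs.ne')
    rw [hiff _ _ h2 h3, h1.norm_add hE, h1.norm_sub hE]
    exact h1.smul_add_smul_sub hE
  obtain ⟨p, hp, -, -⟩ := exists_norm_eq_one_of_two_functionals hdim 0 0
  obtain ⟨q, hq, hpq, -⟩ := exists_norm_eq_one_of_two_functionals hdim (Φ p) 0
  obtain ⟨r, hr, hpr, hqr⟩ := exists_norm_eq_one_of_two_functionals hdim (Φ p) (Φ q)
  have hpp := hself p (hne hp)
  have hqq := hself q (hne hq)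
  have hrr := hself r (hne hr)
  have hli : LinearIndependent ℝ ![p, q, r] := by
    rw [Fintype.linearIndependent_iff]
    intro k hk
    simp only [Fin.sum_univ_three, Matrix.cons_val_zero, Matrix.cons_val_one,
      Matrix.cons_val] at hk
    have e1 := congrArg (Φ p) hk
    have e2 := congrArg (Φ q) hk
    have e3 := congrArg (Φ r) hk
    simp only [map_add, map_smul, map_zero, smul_eq_mul, hpq, hpr, hqr, hsymm _ _ hpq,
      hsymm _ _ hpr, hsymm _ _ hqr, mul_zero, add_zero, zero_add, mul_eq_zero, hpp, hqq, hrr,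
      or_false] at e1 e2 e3
    intro i
    fin_cases i
    exacts [e1, e2, e3]
  have hcoord : ∀ x : E, ∃ a b c : ℝ, x = a • p + b • q + c • r := by
    intro x
    let B := basisOfLinearIndependentOfCardEqFinrank hli (by simp [hdim])
    refine ⟨B.repr x 0, B.repr x 1, B.repr x 2, ?_⟩
    have := B.sum_repr x
    rw [Fin.sum_univ_three] at this
    simpa [B] using this.symm
  have hform : ∀ {a b c a' b' c' : ℝ}, Φ (a • p + b • q + c • r) (a' • p + b' • q + c' • r) = 0 →
      a * a' + b * b' + c * c' = 0 := fun h =>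
    inner_eq_zero_of_polarity hself hsymm (hne hp) hpq hpr hqr (hdiag hp hq hpq)
      (hdiag hp hr hpr) h
  -- Orthogonality of `x + y` and `x - y` makes their dot product, the difference of the squared
  -- Euclidean lengths, vanish.
  have heq : ∀ {a b c a' b' c' : ℝ}, ‖a • p + b • q + c • r‖ = 1 →
      ‖a' • p + b' • q + c' • r‖ = 1 →
      Φ (a • p + b • q + c • r) (a' • p + b' • q + c' • r) = 0 →
      a * a + b * b + c * c = a' * a' + b' * b' + c' * c' := by
    intro a b c a' b' c' h1 h2 h3
    have h4 := hdiag h1 h2 h3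
    have e1 : a • p + b • q + c • r + (a' • p + b' • q + c' • r) =
        (a + a') • p + (b + b') • q + (c + c') • r := by simp only [add_smul]; abel
    have e2 : a • p + b • q + c • r - (a' • p + b' • q + c' • r) =
        (a - a') • p + (b - b') • q + (c - c') • r := by simp only [sub_smul]; abel
    rw [e1, e2] at h4
    have := hform h4
    linarith
  -- A unit vector orthogonal to both `p` and the given vector has the Euclidean length of each, and
  -- `p` has length `1`.
  have hunit : ∀ {a b c : ℝ}, ‖a • p + b • q + c • r‖ = 1 → a * a + b * b + c * c = 1 := by
    intro a b c h
    obtain ⟨z, hz, h1, h2⟩ :=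
      exists_norm_eq_one_of_two_functionals hdim (Φ p) (Φ (a • p + b • q + c • r))
    obtain ⟨a', b', c', rfl⟩ := hcoord z
    have hp' : p = (1 : ℝ) • p + (0 : ℝ) • q + (0 : ℝ) • r := by simp
    rw [heq h hz h2, ← heq (a := 1) (b := 0) (c := 0) (by rwa [← hp']) hz (by rwa [← hp'])]
    norm_num
  have hnorm : ∀ a b c : ℝ, ‖a • p + b • q + c • r‖ * ‖a • p + b • q + c • r‖ =
      a * a + b * b + c * c := by
    intro a b c
    by_cases h0 : a • p + b • q + c • r = 0
    · have := hform (a := a) (b := b) (c := c) (a' := a) (b' := b) (c' := c) (by rw [h0, map_zero])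
      rw [h0, this, norm_zero, mul_zero]
    · have h1 := norm_smul_inv_norm (𝕜 := ℝ) h0
      have hn := norm_ne_zero_iff.2 h0
      set n := ‖a • p + b • q + c • r‖
      have h2 : ‖(n⁻¹ * a) • p + (n⁻¹ * b) • q + (n⁻¹ * c) • r‖ = 1 := by
        simpa only [smul_add, smul_smul, RCLike.ofReal_real_eq_id, id] using h1
      have h3 := hunit h2
      field_simp at h3
      linarith
  obtain ⟨a, b, c, rfl⟩ := hcoord x
  obtain ⟨a', b', c', rfl⟩ := hcoord y
  have e1 : a • p + b • q + c • r + (a' • p + b' • q + c' • r) =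
      (a + a') • p + (b + b') • q + (c + c') • r := by simp only [add_smul]; abel
  have e2 : a • p + b • q + c • r - (a' • p + b' • q + c' • r) =
      (a - a') • p + (b - b') • q + (c - c') • r := by simp only [sub_smul]; abel
  rw [e1, e2, hnorm, hnorm, hnorm, hnorm]
  ring

/-- Adjoining one outside vector at a time raises the dimension by one; `E` itself may be
infinite-dimensional. -/
lemma exists_le_submodule_finrank_eq {n : ℕ} (h : n ≤ Module.rank ℝ E) (k : ℕ) :
    ∀ U : Submodule ℝ E, FiniteDimensional ℝ U → Module.finrank ℝ U + k = n →
      ∃ W : Submodule ℝ E, U ≤ W ∧ Module.finrank ℝ W = n := by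
  induction k with
  | zero => exact fun U _ hU => ⟨U, le_rfl, hU⟩
  | succ k ih =>
    intro U _ hU
    obtain ⟨z, hz⟩ : ∃ z, z ∉ U := by
      by_contra! hall
      have htop : U = ⊤ := (Submodule.eq_top_iff').2 hall
      have h1 : Module.rank ℝ U = Module.rank ℝ E := by rw [htop, rank_top]
      rw [← h1, ← Module.finrank_eq_rank] at h
      have h2 : n ≤ Module.finrank ℝ U := by exact_mod_cast h
      omega
    have h1 : Module.finrank ℝ U < Module.finrank ℝ ↥(U ⊔ Submodule.span ℝ {z}) :=
      Submodule.finrank_lt_finrank_of_lt (left_lt_sup.2 fun hle =>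
        hz (hle (Submodule.mem_span_singleton_self z)))
    have h2 := Submodule.finrank_add_le_finrank_add_finrank U (Submodule.span ℝ {z})
    have h3 := finrank_span_le_card (R := ℝ) ({z} : Set E)
    simp only [Set.toFinset_singleton, Finset.card_singleton] at h3
    obtain ⟨W, hW, hWn⟩ := ih (U ⊔ Submodule.span ℝ {z}) inferInstance (by omega)
    exact ⟨W, le_sup_left.trans hW, hWn⟩

/-- Any two vectors lie in a three-dimensional subspace. -/
lemma exists_submodule_finrank_eq_three (h : 3 ≤ Module.rank ℝ E) (x y : E) :
    ∃ W : Submodule ℝ E, Module.finrank ℝ W = 3 ∧ x ∈ W ∧ y ∈ W := by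
  classical
  have hU : Module.finrank ℝ (Submodule.span ℝ ({x, y} : Set E)) ≤ 2 := by
    refine (finrank_span_le_card (R := ℝ) ({x, y} : Set E)).trans ?_
    rw [Set.toFinset_insert, Set.toFinset_singleton]
    exact Finset.card_le_two
  obtain ⟨W, hle, hW⟩ := exists_le_submodule_finrank_eq (n := 3) (by exact_mod_cast h)
    (3 - Module.finrank ℝ (Submodule.span ℝ ({x, y} : Set E)))
    (Submodule.span ℝ {x, y}) (FiniteDimensional.span_of_finite ℝ (Set.toFinite _)) (by omega)
  exact ⟨W, hW, hle (Submodule.subset_span (by simp)), hle (Submodule.subset_span (by simp))⟩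

lemma isHilbertSpace_of_squareBound [CompleteSpace E] (h : 3 ≤ Module.rank ℝ E)
    (hE : SquareBound E) : IsHilbertSpace E := by
  refine ⟨‹_›, InnerProductSpace.ofNorm (𝕜 := ℝ) fun x y => ?_, rfl⟩
  obtain ⟨W, hW, hx, hy⟩ := exists_submodule_finrank_eq_three h x y
  exact parallelogram_of_finrank_eq_three (E := W) (fun u v => hE u v) hW ⟨x, hx⟩ ⟨y, hy⟩

end Euclidean

theorem theorem4p6 (B : Type*) [NormedAddCommGroup B] [NormedSpace ℝ B] [CompleteSpace B] :
    (2 ≤ Module.rank ℝ B → Real.sqrt 2 ≤ quasiHyperbolicityConstant B) ∧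
    (3 ≤ Module.rank ℝ B → quasiHyperbolicityConstant B = Real.sqrt 2 → IsHilbertSpace B) :=
  ⟨sqrt_two_le_quasiHyperbolicityConstant, fun h hC =>
    isHilbertSpace_of_squareBound h (squareBound_of_quasiHyperbolicityConstant_eq hC)⟩
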